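/- For a smooth map $g$ defined near $0\in\mathbb{C}\cong\mathbb{R}^2$ with values in $\mathbb{R}$ or $\mathbb{C}^N$, let $\mathrm{ord}_0(g)\in\{0,1,2,\dots\}\cup\{\infty\}$ be the least $k$ such that some partial derivative of $g$ of order $k$ is non-zero at $0$ ($\infty$ if there is none). For a smooth real function $k$ defined near $p\in\mathbb{C}^N$, the type of $k$ at $p$ is $$\mathrm{typ}_p(k)=\sup_{\varphi}\frac{\mathrm{ord}_0\big(\zeta\mapsto k(p+\varphi(\zeta))\big)}{\mathrm{ord}_0(\varphi)},$$ the supremum being over all holomorphic maps $\varphi\not\equiv 0$ from the unit disc of $\mathbb{C}$ to $\mathbb{C}^N$ with $\varphi(0)=0$; $k$ is of finite type at $p$ if $\mathrm{typ}_p(k)<\infty$. A set $M$ that is a smooth real hypersurface near $p\in M$ is of finite type $t$ at $p$ if $t<\infty$ and $\mathrm{typ}_p(r)=t$ for the smooth local defining functions $r$ of $M$ near $p$ (that is, $M=\{r=0\}$ near $p$ and $\nabla r\neq 0$). **Proposition.** Let $z_0\in\mathbb{C}^n$, let $U\subset\mathbb{C}^n$ be an open neighbourhood of $z_0$ and $V\subset\mathbb{C}^m$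 an open neighbourhood of $0$. Let $\rho:U\to\mathbb{R}$ be a $\mathcal{C}^\infty$ function with $\rho(z_0)=0$ and $\nabla\rho\neq 0$ everywhere on $U$, and let $h:V\to[0,\infty)$ be a $\mathcal{C}^\infty$ function such that, for $w\in V$, $h(w)\neq 0$ if and only if $w\neq 0$, and $\nabla h(w)\neq 0$ if $w\neq 0$. Put $\partial G=\{z\in U:\rho(z)=0\}$ and assume that at every point of $\partial G$ the Levi form $i\partial\overline\partial\rho$ is non-negative on the complex tangent space of $\partial G$, that is, $\sum_{j,k}\frac{\partial^2\rho}{\partial z_j\partial\overline z_k}(z)v_j\overline{v_k}\ge 0$ for all $z\in\partial G$ and all $v\in\mathbb{C}^n$ with $\sum_j\frac{\partial\rho}{\partial z_j}(z)v_j=0$. Assume that $\partial G$ is of finite type $\tau$ at $z_0$ and that $h$ is of finite type $\mathrm{typ}_0(h)$ at $0$. Then the boundary of $$\widetilde G=\{(z,w)\in U\times V:\rho(z)+h(w)<0\}$$ is, near $(z_0,0)$, a smooth real hypersurface, and it is of finite type exactly $\max(\tau,\mathrm{typ}_0(h))$ at $(z_0,0)$. -/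

import Mathlib

open scoped ENNReal ContDiff

noncomputable section

namespace FiniteType

/-- The order of `g` at `x`: the least `k` such that some partial derivative of `g` of order `k`
does not vanish at `x` (that is, such that the `k`-th derivative of `g` at `x`, as a multilinear
map, is nonzero), and `⊤` if there is none. -/
def order {D F : Type*} [NormedAddCommGroup D] [NormedSpace ℝ D]
    [NormedAddCommGroup F] [NormedSpace ℝ F] (g : D → F) (x : D) : ℕ∞ :=
  ⨅ (k : ℕ) (_ : iteratedFDeriv ℝ k g x ≠ 0), (k : ℕ∞)

/-- `φ` is a holomorphic map on the unit disc of the complex plane with `φ 0 = 0` that is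
not identically zero there (its values outside the unit disc are irrelevant). -/
structure IsDisc {E : Type*} [NormedAddCommGroup E] [NormedSpace ℂ E] (φ : ℂ → E) : Prop where
  holomorphic : DifferentiableOn ℂ φ (Metric.ball 0 1)
  map_zero : φ 0 = 0
  nonzero : ∃ ζ ∈ Metric.ball (0 : ℂ) 1, φ ζ ≠ 0

/-- The type of the function `k` at the point `p`: the supremum of
`order (k (p + φ ·)) / order φ` (orders at the origin) over all nonzero holomorphic maps `φ`
on the unit disc with `φ 0 = 0`. -/
def typeAt {E : Type*} [NormedAddCommGroup E] [NormedSpace ℝ E] [NormedSpace ℂ E]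
    (k : E → ℝ) (p : E) : ℝ≥0∞ :=
  ⨆ (φ : ℂ → E) (_ : IsDisc φ),
    (order (fun ζ => k (p + φ ζ)) 0 : ℝ≥0∞) / (order φ 0 : ℝ≥0∞)

/-- `r` is a smooth local defining function, near the point `p` of `M`, of the set `M`. -/
def IsLocalDefiningFunction {E : Type*} [NormedAddCommGroup E] [NormedSpace ℝ E]
    (M : Set E) (p : E) (r : E → ℝ) : Prop :=
  p ∈ M ∧ ∃ W : Set E, IsOpen W ∧ p ∈ W ∧ ContDiffOn ℝ ∞ r W ∧
    (∀ x ∈ W, fderiv ℝ r x ≠ 0) ∧ ∀ x ∈ W, (x ∈ M ↔ r x = 0)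

/-- Near its point `p` the set `M` is a smooth real hypersurface, and it is of finite type `t`
at `p`: the number `t` is finite, and it is the type at `p` of the local defining functions
of `M` near `p`. -/
def IsOfFiniteType {E : Type*} [NormedAddCommGroup E] [NormedSpace ℝ E] [NormedSpace ℂ E]
    (M : Set E) (p : E) (t : ℝ≥0∞) : Prop :=
  t < ⊤ ∧ (∃ r : E → ℝ, IsLocalDefiningFunction M p r) ∧
    ∀ r : E → ℝ, IsLocalDefiningFunction M p r → typeAt r p = t

/-- The Levi form `∑ j k, (∂² ρ / ∂ z_j ∂ z̄_k) (z) v_j v̄_k` of `ρ` at `z` in the direction `v`,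
written with the real second derivative:
it is a quarter of the Laplacian of `ζ ↦ ρ (z + ζ v)` at the origin. -/
def leviForm {E : Type*} [NormedAddCommGroup E] [NormedSpace ℝ E] [NormedSpace ℂ E]
    (ρ : E → ℝ) (z v : E) : ℝ :=
  (fderiv ℝ (fderiv ℝ ρ) z v v +
    fderiv ℝ (fderiv ℝ ρ) z (Complex.I • v) (Complex.I • v)) / 4

/-- `v` is complex tangent at `z` to the level set of `ρ` through `z`: both `v` and `i v` are
tangent, that is, `∑ j, (∂ ρ / ∂ z_j) (z) v_j = 0`. -/
def IsComplexTangent {E : Type*} [NormedAddCommGroup E] [NormedSpace ℝ E] [NormedSpace ℂ E]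
    (ρ : E → ℝ) (z v : E) : Prop :=
  fderiv ℝ ρ z v = 0 ∧ fderiv ℝ ρ z (Complex.I • v) = 0

end FiniteType

end

noncomputable section

namespace FiniteType

section
open Filter Topology

/-! The function `ρ z + h w` defines the boundary near `(z₀, 0)`: its gradient is nonzero already in
the `z` directions. Two defining functions of one hypersurface are each `O` of the other, so they
have the same order along every disc and the same type. It remains to compute the type of `ρ z + h
w`. The discs `(ψ, 0)` and `(0, χ)` give the lower bound. For the upper bound, the order of `(ψ, χ)`
is the smaller of the two orders, so it is enough that nothing cancels: if `ρ (z₀ + ψ) + h χ` has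
order at least `N`, so does each summand (`le_order_of_le_order_add`). Otherwise the leading
homogeneous parts `Q` of `ρ (z₀ + ψ)` and `P` of `h χ` would satisfy `Q + P = 0` with `P ≥ 0`, hence
`Q ≤ 0`. Pseudoconvexity makes `Q` subharmonic (`leviForm_homogeneous_part_nonneg`): the Levi form
of `ρ` near the hypersurface is bounded below by minus a multiple of `|ρ|` plus the complex normal
part of the direction, and along the curve this error vanishes to higher order than the Laplacian of
`Q`. A nonpositive subharmonic homogeneous function of positive degree on the plane is zero
(`eq_zero_of_leviForm_nonneg`), so both leading parts vanish. Orders are handled as growth rates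
through `le_order_iff_isBigO`. -/

theorem contDiffAt_fderiv {D F : Type*} [NormedAddCommGroup D] [NormedSpace ℝ D]
    [NormedAddCommGroup F] [NormedSpace ℝ F] {g : D → F} {x : D} (hg : ContDiffAt ℝ ∞ g x) :
    ContDiffAt ℝ ∞ (fderiv ℝ g) x :=
  hg.fderiv_right (by simp)

theorem eventually_contDiffAt {D F : Type*} [NormedAddCommGroup D] [NormedSpace ℝ D]
    [NormedAddCommGroup F] [NormedSpace ℝ F] {g : D → F} {x : D} (hg : ContDiffAt ℝ ∞ g x) (n : ℕ) :
    ∀ᶠ y in 𝓝 x, ContDiffAt ℝ n g y :=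
  (hg.of_le (by exact_mod_cast le_top)).eventually (by simp)

end

universe u

/-! ### Vanishing orders, growth rates and leading homogeneous parts. -/

section
variable {D F : Type u} [NormedAddCommGroup D] [NormedSpace ℝ D]
  [NormedAddCommGroup F] [NormedSpace ℝ F]
open Filter Topology Asymptotics

theorem le_order_iff {g : D → F} {x : D} {N : ℕ} :
    (N : ℕ∞) ≤ order g x ↔ ∀ k < N, iteratedFDeriv ℝ k g x = 0 := by
  simp only [order, le_iInf_iff, Nat.cast_le]
  exact forall_congr' fun k => by rw [← not_imp_not, not_le, not_not]

theorem order_congr {g g' : D → F} {x : D} (hgg' : g =ᶠ[𝓝 x] g') : order g x = order g' x := by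
  have h k : iteratedFDeriv ℝ k g x = iteratedFDeriv ℝ k g' x :=
    (hgg'.iteratedFDeriv ℝ k).self_of_nhds
  simp only [order, h]

/-- The engine for inductions on the order. Passing to the derivative replaces `F` by a space of
linear maps, so those inductions quantify over the target space, and `D` and `F` share a universe.
-/
theorem succ_le_order_iff {g : D → F} {x : D} {N : ℕ} :
    ((N + 1 : ℕ) : ℕ∞) ≤ order g x ↔ g x = 0 ∧ (N : ℕ∞) ≤ order (fderiv ℝ g) x := by
  have key (k : ℕ) : iteratedFDeriv ℝ (k + 1) g x = 0 ↔
      iteratedFDeriv ℝ k (fderiv ℝ g) x = 0 := by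
    rw [← norm_eq_zero, ← norm_iteratedFDeriv_fderiv, norm_eq_zero]
  have key0 : iteratedFDeriv ℝ 0 g x = 0 ↔ g x = 0 := by
    rw [← norm_eq_zero, norm_iteratedFDeriv_zero, norm_eq_zero]
  simp only [le_order_iff]
  constructor
  · exact fun hk => ⟨key0.1 (hk 0 (by omega)), fun k hkN => (key k).1 (hk _ (by omega))⟩
  · rintro ⟨h0, h1⟩ (_ | k) hk
    · exact key0.2 h0
    · exact (key k).2 (h1 k (by omega))

/-- A smooth function of order at least `N` at the origin is `O(‖x‖ ^ N)`. -/
theorem isBigO_of_le_order (N : ℕ) : ∀ {F : Type u} [NormedAddCommGroup F] [NormedSpace ℝ F]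
    {g : D → F}, ContDiffAt ℝ ∞ g 0 → (N : ℕ∞) ≤ order g 0 →
    g =O[𝓝 0] fun x => ‖x‖ ^ N := by
  induction N with
  | zero =>
    intro F _ _ g hg _
    simpa using hg.continuousAt.isBigO_one ℝ
  | succ N ih =>
    intro F _ _ g hg hN
    obtain ⟨h0, h1⟩ := succ_le_order_iff.1 hN
    obtain ⟨C, hC⟩ := (ih (contDiffAt_fderiv hg) h1).bound
    have hd := eventually_contDiffAt hg 1
    obtain ⟨ε, hε, hball⟩ := Metric.eventually_nhds_iff_ball.1 (hC.and hd)
    refine IsBigO.of_bound C ?_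
    filter_upwards [Metric.ball_mem_nhds 0 hε] with x hx
    have hx' : ‖x‖ < ε := by simpa using hx
    have hsub : Metric.closedBall (0 : D) ‖x‖ ⊆ Metric.ball 0 ε :=
      Metric.closedBall_subset_ball hx'
    -- The `O`-constant is not known to be nonnegative; it can be negative only where the bounding
    -- function vanishes.
    have hC0 : 0 ≤ C ∨ ‖x‖ ^ N = 0 := by
      by_contra! hcon
      have h2 := (hball x hx).1
      have : 0 < ‖x‖ ^ N := lt_of_le_of_ne (by positivity) (Ne.symm hcon.2)
      rw [norm_pow, norm_norm] at h2
      nlinarith [norm_nonneg (fderiv ℝ g x)]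
    have := (convex_closedBall (0 : D) ‖x‖).norm_image_sub_le_of_norm_fderiv_le (𝕜 := ℝ)
      (f := g) (C := C * ‖x‖ ^ N) (x := 0) (y := x)
      (fun y hy => (hball y (hsub hy)).2.differentiableAt (by simp))
      (fun y hy => by
        have h2 := (hball y (hsub hy)).1
        have h3 : ‖y‖ ≤ ‖x‖ := by simpa using hy
        rw [norm_pow, norm_norm] at h2
        rcases hC0 with hC0 | hC0
        · exact h2.trans (by gcongr)
        · have : ‖y‖ ^ N = 0 := le_antisymm
            ((pow_le_pow_left₀ (norm_nonneg _) h3 N).trans hC0.le) (by positivity)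
          rw [hC0]; rwa [this] at h2)
      (by simp) (by simp)
    rw [h0, sub_zero, sub_zero] at this
    simpa [pow_succ, mul_assoc] using this

/-- Rescaling towards the origin kills a function whose growth exponent exceeds its degree by one.
The degree is encoded as `b - a`, so that degree `-1`, met for the derivative of a constant, needs
no separate treatment. -/
theorem eq_zero_of_homogeneous {Q : D → F} {a b c : ℕ} (habc : a + c = b + 1)
    (hQ : ∀ (t : ℝ) x, t ^ a • Q (t • x) = t ^ b • Q x)
    (hO : Q =O[𝓝 0] fun x => ‖x‖ ^ c) (x : D) : Q x = 0 := by
  obtain ⟨C, hC⟩ := hO.bound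
  have ht : Tendsto (fun t : ℝ => t • x) (𝓝[>] 0) (𝓝 0) := by
    have : Continuous fun t : ℝ => t • x := by fun_prop
    simpa using (this.tendsto 0).mono_left nhdsWithin_le_nhds
  have h1 : ∀ᶠ t : ℝ in 𝓝[>] 0, ‖Q x‖ ≤ C * ‖x‖ ^ c * t := by
    filter_upwards [ht.eventually hC, self_mem_nhdsWithin] with t h ht
    have ht : 0 < t := ht
    have e := congrArg norm (hQ t x)
    rw [norm_smul, norm_smul, norm_pow, norm_pow, Real.norm_of_nonneg ht.le] at e
    rw [norm_pow, norm_norm, norm_smul, Real.norm_of_nonneg ht.le, mul_pow] at h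
    have hb : 0 < t ^ b := by positivity
    refine le_of_mul_le_mul_left ?_ hb
    calc t ^ b * ‖Q x‖ = t ^ a * ‖Q (t • x)‖ := e.symm
      _ ≤ t ^ a * (C * (t ^ c * ‖x‖ ^ c)) := by gcongr
      _ = t ^ (a + c) * (C * ‖x‖ ^ c) := by ring
      _ = t ^ b * (C * ‖x‖ ^ c * t) := by rw [habc]; ring
  have h2 : Tendsto (fun t : ℝ => C * ‖x‖ ^ c * t) (𝓝[>] 0) (𝓝 0) := by
    have : Continuous fun t : ℝ => C * ‖x‖ ^ c * t := by fun_prop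
    simpa using (this.tendsto 0).mono_left nhdsWithin_le_nhds
  exact norm_le_zero_iff.1 (ge_of_tendsto h2 h1)

theorem fderiv_homogeneous {Q : D → F} (hs : Differentiable ℝ Q) {t a b : ℝ}
    (hQ : ∀ x, a • Q (t • x) = b • Q x) (x : D) :
    (a * t) • fderiv ℝ Q (t • x) = b • fderiv ℝ Q x := by
  have h1 : HasFDerivAt (fun y => a • Q (t • y)) ((a * t) • fderiv ℝ Q (t • x)) x := by
    have := ((hs (t • x)).hasFDerivAt.comp x ((hasFDerivAt_id x).const_smul t)).const_smul a
    rwa [ContinuousLinearMap.comp_smul, ContinuousLinearMap.comp_id, smul_smul] at this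
  have h2 : HasFDerivAt (fun y => b • Q y) (b • fderiv ℝ Q x) x :=
    (hs x).hasFDerivAt.const_smul _
  simp only [hQ] at h1
  exact h1.unique h2

/-- Euler's identity, from differentiating along the ray at `t = 1`. -/
theorem fderiv_homogeneous_self {Q : D → F} (hs : Differentiable ℝ Q) {N : ℕ}
    (hQ : ∀ (t : ℝ) x, Q (t • x) = t ^ N • Q x) (x : D) :
    fderiv ℝ Q x x = (N : ℝ) • Q x := by
  have h1 : HasDerivAt (fun t : ℝ => Q (t • x)) (fderiv ℝ Q x x) 1 := by
    have h := (hs ((1 : ℝ) • x)).hasFDerivAt.comp_hasDerivAt (1 : ℝ)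
      ((hasDerivAt_id (1 : ℝ)).smul_const x)
    simpa [Function.comp_def] using h
  have h2 : HasDerivAt (fun t : ℝ => t ^ N • Q x) ((N : ℝ) • Q x) 1 := by
    simpa using (hasDerivAt_pow N (1 : ℝ)).smul_const (Q x)
  simp only [hQ] at h1
  exact h1.unique h2

/-- The leading homogeneous part of a smooth function of order at least `N` at the origin. -/
theorem exists_homogeneous_part (N : ℕ) : ∀ {F : Type u} [NormedAddCommGroup F]
    [NormedSpace ℝ F] {g : D → F}, ContDiffAt ℝ ∞ g 0 → (N : ℕ∞) ≤ order g 0 →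
    ∃ Q : D → F, ContDiff ℝ ∞ Q ∧ (∀ (t : ℝ) x, Q (t • x) = t ^ N • Q x) ∧
      ((N + 1 : ℕ) : ℕ∞) ≤ order (fun x => g x - Q x) 0 := by
  induction N with
  | zero =>
    intro F _ _ g hg _
    refine ⟨fun _ => g 0, contDiff_const, by simp, ?_⟩
    rw [succ_le_order_iff]
    simp
  | succ N ih =>
    intro F _ _ g hg hN
    obtain ⟨h0, h1⟩ := succ_le_order_iff.1 hN
    obtain ⟨P, hPs, hPh, hPo⟩ := ih (contDiffAt_fderiv hg) h1
    have hPd : Differentiable ℝ P := hPs.differentiable (by simp)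
    have hdd : (fderiv ℝ fun x => fderiv ℝ g x - P x) =ᶠ[𝓝 0]
        fun x => fderiv ℝ (fderiv ℝ g) x - fderiv ℝ P x := by
      filter_upwards [eventually_contDiffAt (contDiffAt_fderiv hg) 1] with x hx
      exact fderiv_fun_sub (hx.differentiableAt (by simp)) (hPd x)
    have hO := isBigO_of_le_order N
      (contDiffAt_fderiv ((contDiffAt_fderiv hg).sub hPs.contDiffAt)) (succ_le_order_iff.1 hPo).2
    -- `P`, the leading part of `fderiv ℝ g`, is a closed form: its derivative differs from the
    -- symmetric second derivative of `g` by `O(‖y‖ ^ N)`, while its antisymmetric part is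
    -- homogeneous of degree `N - 1`.
    have hsymm (x v w : D) : fderiv ℝ P x v w = fderiv ℝ P x w v := by
      obtain ⟨C, hC⟩ := hO.bound
      set A : D → F := fun y => fderiv ℝ P y v w - fderiv ℝ P y w v with hA
      have hAh (t : ℝ) (y : D) : t • A (t • y) = t ^ N • A y := by
        have := fderiv_homogeneous hPd (a := 1) (fun x => by rw [one_smul]; exact hPh t x) y
        rw [one_mul] at this
        have e1 := congrArg (fun L => L v w) this
        have e2 := congrArg (fun L => L w v) this
        simp only [_root_.smul_apply] at e1 e2
        simp only [hA, smul_sub, e1, e2]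
      have hAO : (fun y => A y) =O[𝓝 0] fun y => ‖y‖ ^ N := by
        refine IsBigO.of_bound (C * (‖v‖ * ‖w‖ + ‖w‖ * ‖v‖)) ?_
        filter_upwards [hC, hdd, eventually_contDiffAt hg 2] with y h1 h2 h3
        have hs := h3.isSymmSndFDerivAt (by simp) v w
        rw [h2, norm_pow, norm_norm] at h1
        have : A y = (fderiv ℝ (fderiv ℝ g) y - fderiv ℝ P y) w v -
            (fderiv ℝ (fderiv ℝ g) y - fderiv ℝ P y) v w := by
          simp only [hA, _root_.sub_apply, hs]; abel
        rw [this]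
        refine (norm_sub_le _ _).trans ?_
        have b := ContinuousLinearMap.le_opNorm₂ (fderiv ℝ (fderiv ℝ g) y - fderiv ℝ P y)
        refine (add_le_add (b w v) (b v w)).trans ?_
        rw [norm_pow, norm_norm]
        calc _ = ‖fderiv ℝ (fderiv ℝ g) y - fderiv ℝ P y‖ * (‖v‖ * ‖w‖ + ‖w‖ * ‖v‖) := by ring
          _ ≤ C * ‖y‖ ^ N * (‖v‖ * ‖w‖ + ‖w‖ * ‖v‖) := by gcongr
          _ = _ := by ring
      exact sub_eq_zero.1 (eq_zero_of_homogeneous (a := 1) (b := N) (c := N) (add_comm _ _)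
        (fun t y => by rw [pow_one]; exact hAh t y) hAO x)
    -- Poincaré lemma for homogeneous forms: with symmetry and Euler's identity, `P x x / (N + 1)`
    -- is a primitive of `P`.
    have hQd (x : D) : HasFDerivAt (fun x => ((N : ℝ) + 1)⁻¹ • P x x) (P x) x := by
      have h := ((hPd x).hasFDerivAt.clm_apply (hasFDerivAt_id x)).fun_const_smul ((N : ℝ) + 1)⁻¹
      refine h.congr_fderiv (ContinuousLinearMap.ext fun v => ?_)
      have e : fderiv ℝ P x v x = (N : ℝ) • P x v := by
        rw [hsymm, fderiv_homogeneous_self hPd hPh]; rfl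
      change ((N : ℝ) + 1)⁻¹ • (P x v + fderiv ℝ P x v x) = P x v
      rw [e, show P x v + (N : ℝ) • P x v = ((N : ℝ) + 1) • P x v by rw [add_smul, one_smul, add_comm],
        smul_smul, inv_mul_cancel₀ (by positivity), one_smul]
    refine ⟨fun x => ((N : ℝ) + 1)⁻¹ • P x x, (hPs.clm_apply contDiff_id).const_smul _,
      fun t x => ?_, ?_⟩
    · simp only [hPh, map_smul, _root_.smul_apply, smul_smul]
      congr 1; ring
    · rw [succ_le_order_iff]
      refine ⟨by simp [h0], ?_⟩
      rw [order_congr (g' := fun x => fderiv ℝ g x - P x)]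
      · exact hPo
      · filter_upwards [eventually_contDiffAt hg 1] with x hx
        rw [fderiv_fun_sub (hx.differentiableAt (by simp)) (hQd x).differentiableAt, (hQd x).fderiv]

/-- For the converse, the leading part of each degree below `N` inherits growth one degree too high,
hence vanishes, and the order increases. -/
theorem le_order_iff_isBigO {g : D → F} (hg : ContDiffAt ℝ ∞ g 0) {N : ℕ} :
    (N : ℕ∞) ≤ order g 0 ↔ g =O[𝓝 0] fun x => ‖x‖ ^ N := by
  refine ⟨isBigO_of_le_order N hg, fun hO => ?_⟩
  have key (k : ℕ) (hk : k ≤ N) : (k : ℕ∞) ≤ order g 0 := by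
    induction k with
    | zero => simp
    | succ k ih =>
      obtain ⟨Q, hQs, hQh, hQo⟩ := exists_homogeneous_part k hg (ih (by omega))
      have h1 := isBigO_of_le_order (k + 1) (hg.sub hQs.contDiffAt) hQo
      have h2 : (fun x : D => ‖x‖ ^ N) =O[𝓝 0] fun x => ‖x‖ ^ (k + 1) := by
        refine IsBigO.of_bound 1 ?_
        filter_upwards [Metric.ball_mem_nhds (0 : D) one_pos] with x hx
        rw [norm_pow, norm_pow, norm_norm, one_mul]
        exact pow_le_pow_of_le_one (norm_nonneg _) (by simpa using (mem_ball_zero_iff.1 hx).le) hk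
      have h3 : Q =O[𝓝 0] fun x => ‖x‖ ^ (k + 1) := by
        simpa using (hO.trans h2).sub h1
      have h4 := eq_zero_of_homogeneous (a := 0) (zero_add _)
        (fun t x => by rw [pow_zero, one_smul]; exact hQh t x) h3
      simpa [h4] using hQo
  exact key N le_rfl

end

/-! ### Defining functions of a hypersurface, and Levi forms near it. -/

section

open Filter Topology Asymptotics

/-- Moving in a transversal direction `ν`, one reaches the zero set of `r` from a nearby point `z`
after a time controlled by `|r z|`. -/
theorem eventually_exists_zero {E : Type*} [NormedAddCommGroup E] [NormedSpace ℝ E]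
    {r : E → ℝ} {p ν : E} (hr : ContDiffAt ℝ ∞ r p) (hp : r p = 0) (hν : fderiv ℝ r p ν = 1)
    {S : Set E} (hS : S ∈ 𝓝 p) :
    ∀ᶠ z in 𝓝 p, ∃ t : ℝ, |t| ≤ 2 * |r z| ∧ r (z + t • ν) = 0 ∧ z + t • ν ∈ S := by
  have h1 : ∀ᶠ z in 𝓝 p, 1 / 2 < fderiv ℝ r z ν := by
    have hc : ContinuousAt (fun z => fderiv ℝ r z ν) p :=
      (contDiffAt_fderiv hr).continuousAt.clm_apply continuousAt_const
    exact hc.eventually_const_lt (by simp only [hν]; norm_num)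
  obtain ⟨ε, hε, hb⟩ := Metric.eventually_nhds_iff_ball.1
    ((h1.and (eventually_contDiffAt hr 1)).and hS)
  have h2 : ∀ᶠ z in 𝓝 p, ‖z - p‖ + 2 * |r z| * ‖ν‖ < ε := by
    have hc : ContinuousAt (fun z => ‖z - p‖ + 2 * |r z| * ‖ν‖) p := by
      have := hr.continuousAt
      fun_prop
    exact hc.eventually_lt_const (by simpa [hp] using hε)
  filter_upwards [h2] with z hz
  set T := 2 * |r z| with hT
  have hT0 : 0 ≤ T := by positivity
  have hmem (t : ℝ) (ht : t ∈ Set.Icc (-T) T) : z + t • ν ∈ Metric.ball p ε := by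
    rw [mem_ball_iff_norm]
    calc ‖z + t • ν - p‖ = ‖(z - p) + t • ν‖ := by congr 1; abel
      _ ≤ ‖z - p‖ + |t| * ‖ν‖ := (norm_add_le _ _).trans_eq (by rw [norm_smul, Real.norm_eq_abs])
      _ ≤ ‖z - p‖ + T * ‖ν‖ := by gcongr; exact abs_le.2 ht
      _ < ε := hz
  have hd (t : ℝ) (ht : t ∈ Set.Icc (-T) T) :
      HasDerivAt (fun t : ℝ => r (z + t • ν) - t / 2) (fderiv ℝ r (z + t • ν) ν - 1 / 2) t := by
    have h := ((hb _ (hmem t ht)).1.2.differentiableAt (by simp)).hasFDerivAt.comp_hasDerivAt t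
      (((hasDerivAt_id t).smul_const ν).const_add z)
    simpa [Function.comp_def] using h.fun_sub ((hasDerivAt_id t).div_const 2)
  -- Along `ν` the function `r` grows at speed at least `1/2`, so within time `2 * |r z|` in one
  -- direction or the other it reaches zero.
  have hmono : MonotoneOn (fun t : ℝ => r (z + t • ν) - t / 2) (Set.Icc (-T) T) := by
    refine monotoneOn_of_deriv_nonneg (convex_Icc _ _)
      (fun t ht => (hd t ht).continuousAt.continuousWithinAt)
      (fun t ht => (hd t (interior_subset ht)).differentiableAt.differentiableWithinAt)
      (fun t ht => ?_)
    rw [(hd t (interior_subset ht)).deriv]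
    linarith [(hb _ (hmem t (interior_subset ht))).1.1]
  have hcont : ContinuousOn (fun t : ℝ => r (z + t • ν)) (Set.Icc (-T) T) := fun t ht => by
    have := ((hd t ht).continuousAt.add (continuousAt_id.div_const 2)).continuousWithinAt
      (s := Set.Icc (-T) T)
    refine this.congr (fun y _ => ?_) ?_ <;> simp
  have hl : (-T) ∈ Set.Icc (-T) T := ⟨le_rfl, by linarith⟩
  have hr' : T ∈ Set.Icc (-T) T := ⟨by linarith, le_rfl⟩
  have h0 : (0 : ℝ) ∈ Set.Icc (-T) T := ⟨by linarith, hT0⟩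
  have e1 := hmono hl h0 (by linarith)
  have e2 := hmono h0 hr' hT0
  simp only [zero_smul, add_zero, zero_div, sub_zero] at e1 e2
  obtain ⟨t, ht, ht0⟩ := intermediate_value_Icc (by linarith) hcont
    (show (0 : ℝ) ∈ _ from ⟨by linarith [le_abs_self (r z)], by linarith [neg_abs_le (r z)]⟩)
  exact ⟨t, abs_le.2 ht, ht0, (hb _ (hmem t ht)).2⟩

theorem exists_apply_eq_one {E : Type*} [NormedAddCommGroup E] [NormedSpace ℝ E]
    {L : E →L[ℝ] ℝ} (hL : L ≠ 0) : ∃ ν, L ν = 1 := by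
  obtain ⟨v, hv⟩ := DFunLike.ne_iff.1 hL
  exact ⟨(L v)⁻¹ • v, by simpa using inv_mul_cancel₀ hv⟩

/-- From `z` the zero set of `r` is reached within distance `O(|r z|)`; there `r'` vanishes, and
`r'` is Lipschitz. -/
theorem isBigO_of_zero_imp_zero {E : Type*} [NormedAddCommGroup E] [NormedSpace ℝ E]
    {r r' : E → ℝ} {p : E} (hr : ContDiffAt ℝ ∞ r p) (hp : r p = 0) (hd : fderiv ℝ r p ≠ 0)
    (hr' : ContDiffAt ℝ ∞ r' p) (hz : ∀ᶠ z in 𝓝 p, r z = 0 → r' z = 0) :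
    r' =O[𝓝 p] r := by
  obtain ⟨ν, hν⟩ := exists_apply_eq_one hd
  obtain ⟨K, S, hS, hK⟩ := (hr'.of_le (by simp) : ContDiffAt ℝ 1 r' p).exists_lipschitzOnWith
  refine IsBigO.of_bound (K * (2 * ‖ν‖)) ?_
  filter_upwards [eventually_exists_zero hr hp hν (inter_mem hS hz), hS] with z ⟨t, ht, h0, h1, h2⟩ hzS
  have := hK.dist_le_mul z hzS _ h1
  rw [h2 h0, dist_zero_right, dist_self_add_right, norm_smul] at this
  refine this.trans ?_
  calc (K : ℝ) * (|t| * ‖ν‖) ≤ K * (2 * |r z| * ‖ν‖) := by gcongr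
    _ = K * (2 * ‖ν‖) * ‖r z‖ := by rw [Real.norm_eq_abs]; ring

theorem contDiffAt_comp_disc {E : Type*} [NormedAddCommGroup E] [NormedSpace ℝ E]
    {φ : ℂ → E} {r : E → ℝ} {p : E} (hφ : ContDiffAt ℝ ∞ φ 0)
    (h0 : φ 0 = 0) (hr : ContDiffAt ℝ ∞ r p) : ContDiffAt ℝ ∞ (fun ζ => r (p + φ ζ)) 0 := by
  have h1 : ContDiffAt ℝ ∞ (fun ζ => p + φ ζ) 0 := contDiffAt_const.add hφ
  exact ContDiffAt.comp (0 : ℂ) (g := r) (by simpa [h0] using hr) h1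

theorem tendsto_disc {E : Type*} [NormedAddCommGroup E] [NormedSpace ℝ E]
    {φ : ℂ → E} (hφ : ContDiffAt ℝ ∞ φ 0) (h0 : φ 0 = 0) (p : E) :
    Tendsto (fun ζ => p + φ ζ) (𝓝 0) (𝓝 p) := by
  simpa [h0] using (hφ.continuousAt.tendsto.const_add p)

theorem order_le_order_of_zero_imp_zero {E : Type} [NormedAddCommGroup E] [NormedSpace ℝ E]
    {r r' : E → ℝ} {p : E} (hr : ContDiffAt ℝ ∞ r p)
    (hp : r p = 0) (hd : fderiv ℝ r p ≠ 0) (hr' : ContDiffAt ℝ ∞ r' p)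
    (hz : ∀ᶠ z in 𝓝 p, r z = 0 → r' z = 0) {φ : ℂ → E} (hφ : ContDiffAt ℝ ∞ φ 0) (h0 : φ 0 = 0) :
    order (fun ζ => r (p + φ ζ)) 0 ≤ order (fun ζ => r' (p + φ ζ)) 0 := by
  refine ENat.forall_natCast_le_iff_le.1 fun N hN => ?_
  rw [le_order_iff_isBigO (contDiffAt_comp_disc hφ h0 hr)] at hN
  rw [le_order_iff_isBigO (contDiffAt_comp_disc hφ h0 hr')]
  exact ((isBigO_of_zero_imp_zero hr hp hd hr' hz).comp_tendsto (tendsto_disc hφ h0 p)).trans hN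

theorem abs_apply_sub_apply_le {E : Type*} [NormedAddCommGroup E] [NormedSpace ℝ E]
    (B B' : E →L[ℝ] E →L[ℝ] ℝ) (v v' : E) :
    |B v v - B' v' v'| ≤ ‖B - B'‖ * ‖v‖ * ‖v‖ + ‖B'‖ * ‖v - v'‖ * (‖v‖ + ‖v'‖) := by
  have e : B v v - B' v' v' = (B - B') v v + B' (v - v') v + B' v' (v - v') := by
    simp only [_root_.sub_apply, map_sub]; abel
  rw [e]
  refine (abs_add_three _ _ _).trans ?_
  have h1 := (B - B').le_opNorm₂ v v
  have h2 := B'.le_opNorm₂ (v - v') v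
  have h3 := B'.le_opNorm₂ v' (v - v')
  rw [Real.norm_eq_abs] at h1 h2 h3
  linarith

variable {E : Type} [NormedAddCommGroup E] [NormedSpace ℝ E] [NormedSpace ℂ E]
  [IsScalarTower ℝ ℂ E]

theorem IsDisc.contDiffAt [CompleteSpace E] {φ : ℂ → E} (hφ : IsDisc φ) : ContDiffAt ℝ ∞ φ 0 := by
  have h : ContDiffAt ℂ ∞ φ 0 :=
    (hφ.holomorphic.contDiffOn Metric.isOpen_ball).contDiffAt (Metric.ball_mem_nhds 0 one_pos)
  exact h.restrict_scalars ℝ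

theorem typeAt_eq_of_zero_iff [CompleteSpace E] {r r' : E → ℝ} {p : E} (hr : ContDiffAt ℝ ∞ r p)
    (hp : r p = 0) (hd : fderiv ℝ r p ≠ 0) (hr' : ContDiffAt ℝ ∞ r' p) (hd' : fderiv ℝ r' p ≠ 0)
    (hz : ∀ᶠ z in 𝓝 p, r z = 0 ↔ r' z = 0) : typeAt r p = typeAt r' p := by
  have hp' : r' p = 0 := hz.self_of_nhds.1 hp
  refine iSup_congr fun φ => iSup_congr fun hφ => ?_
  rw [le_antisymm
    (order_le_order_of_zero_imp_zero hr hp hd hr' (hz.mono fun _ h => h.1) hφ.contDiffAt hφ.map_zero)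
    (order_le_order_of_zero_imp_zero hr' hp' hd' hr (hz.mono fun _ h => h.2) hφ.contDiffAt
      hφ.map_zero)]

/-- The map `w ↦ A w - i A (i w)` is complex linear with kernel the complex tangent space, so `c` is
the quotient of its values at `v` and `ν`. -/
theorem exists_complexTangent {A : E →L[ℝ] ℝ} {ν : E} (hν : 1 / 2 ≤ A ν) (v : E) :
    ∃ c : ℂ, A (v - c • ν) = 0 ∧ A (Complex.I • (v - c • ν)) = 0 ∧
      ‖c‖ ≤ 2 * (|A v| + |A (Complex.I • v)|) := by
  set P : E → ℂ := fun w => (A w : ℂ) - Complex.I * (A (Complex.I • w) : ℂ) with hP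
  have hsmul (c : ℂ) (w : E) : P (c • w) = c * P w := by
    have e1 : c • w = c.re • w + c.im • (Complex.I • w) := by
      conv_lhs => rw [← Complex.re_add_im c]
      rw [add_smul, mul_smul, ← algebraMap_smul ℂ c.re w, ← algebraMap_smul ℂ c.im (Complex.I • w)]
      rfl
    have e2 : Complex.I • (c • w) = c.re • (Complex.I • w) - c.im • w := by
      rw [e1, smul_add, smul_comm Complex.I c.re w, smul_comm Complex.I c.im, smul_smul Complex.I,
        Complex.I_mul_I, neg_one_smul, smul_neg, sub_eq_add_neg]
    simp only [hP, e2, map_sub, map_smul, smul_eq_mul]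
    rw [e1]
    simp only [map_add, map_smul, smul_eq_mul]
    exact Complex.ext (by simp) (by simp; ring)
  have hsub (w w' : E) : P (w - w') = P w - P w' := by
    simp only [hP, smul_sub, map_sub]; push_cast; ring
  have hre (w : E) : (P w).re = A w := by simp [hP]
  have him (w : E) : (P w).im = -A (Complex.I • w) := by simp [hP]
  have hν' : 1 / 2 ≤ ‖P ν‖ := hν.trans ((hre ν).symm.le.trans (Complex.re_le_norm _))
  have hν0 : P ν ≠ 0 := fun h => by rw [h, norm_zero] at hν'; norm_num at hν'
  have hz : P (v - (P v / P ν) • ν) = 0 := by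
    rw [hsub, hsmul, div_mul_cancel₀ _ hν0, sub_self]
  refine ⟨P v / P ν, by rw [← hre, hz]; rfl, ?_, ?_⟩
  · have := him (v - (P v / P ν) • ν)
    rw [hz] at this
    simpa using this
  · rw [norm_div, div_le_iff₀ (by linarith)]
    have h1 : ‖P v‖ ≤ |A v| + |A (Complex.I • v)| := by
      have := Complex.norm_le_abs_re_add_abs_im (P v)
      rwa [hre, him, abs_neg] at this
    nlinarith [abs_nonneg (A v), abs_nonneg (A (Complex.I • v))]

/-- Pseudoconvexity of the zero set of `ρ` bounds the Levi form of `ρ` from below also at nearby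
points and in nearby directions. -/
theorem exists_leviForm_lower_bound {ρ : E → ℝ} {z₀ : E} (hρ : ContDiffAt ℝ ∞ ρ z₀)
    (h0 : ρ z₀ = 0) (hd : fderiv ℝ ρ z₀ ≠ 0)
    (hL : ∀ᶠ z in 𝓝 z₀, ρ z = 0 → ∀ v, IsComplexTangent ρ z v → 0 ≤ leviForm ρ z v)
    {K : ℝ} (hK : 0 ≤ K) :
    ∃ C : ℝ, 0 ≤ C ∧ ∀ᶠ z in 𝓝 z₀, ∀ v, ‖v‖ ≤ K →
      -(C * (|ρ z| + (|fderiv ℝ ρ z v| + |fderiv ℝ ρ z (Complex.I • v)|))) ≤ leviForm ρ z v := by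
  obtain ⟨ν, hν⟩ := exists_apply_eq_one hd
  have hA := contDiffAt_fderiv hρ
  have hB := contDiffAt_fderiv hA
  obtain ⟨L₁, S₁, hS₁, hL₁⟩ :=
    (hA.of_le (by simp) : ContDiffAt ℝ 1 (fderiv ℝ ρ) z₀).exists_lipschitzOnWith
  obtain ⟨L₂, S₂, hS₂, hL₂⟩ :=
    (hB.of_le (by simp) : ContDiffAt ℝ 1 (fderiv ℝ (fderiv ℝ ρ)) z₀).exists_lipschitzOnWith
  have h1 : ∀ᶠ z in 𝓝 z₀, 1 / 2 < fderiv ℝ ρ z ν :=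
    (hA.continuousAt.clm_apply continuousAt_const).eventually_const_lt (by simp only [hν]; norm_num)
  have h2 : ∀ᶠ z in 𝓝 z₀, ‖fderiv ℝ ρ z‖ < ‖fderiv ℝ ρ z₀‖ + 1 :=
    hA.continuousAt.norm.eventually_lt_const (by linarith)
  have h3 : ∀ᶠ z in 𝓝 z₀, ‖fderiv ℝ (fderiv ℝ ρ) z‖ < ‖fderiv ℝ (fderiv ℝ ρ) z₀‖ + 1 :=
    hB.continuousAt.norm.eventually_lt_const (by linarith)
  set M₁ := ‖fderiv ℝ ρ z₀‖ + 1
  set M₂ := ‖fderiv ℝ (fderiv ℝ ρ) z₀‖ + 1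
  have hM₁ : 0 ≤ M₁ := by positivity
  have hM₂ : 0 ≤ M₂ := by positivity
  set c₁ : ℝ := 2 + 8 * L₁ * K * ‖ν‖ with hc₁
  set K' : ℝ := K + 4 * M₁ * K * ‖ν‖ with hK'
  -- The first summand pays for moving `z` to the zero set, the second for projecting `v` to a
  -- complex tangent vector `v'`, with `K'` bounding `‖v'‖`. Two Hessian terms over the factor `4`
  -- leave the division by `2`.
  refine ⟨(2 * L₂ * ‖ν‖ * K * K + M₂ * ‖ν‖ * c₁ * (K + K')) / 2, by positivity, ?_⟩
  filter_upwards [eventually_exists_zero hρ h0 hν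
    (inter_mem (inter_mem hS₁ hS₂) (inter_mem (inter_mem h1 h2) (inter_mem h3 hL))), hS₁, hS₂]
    with z ⟨t, ht, hz0, ⟨hz₁, hz₂⟩, ⟨ha, hb⟩, hc, he⟩ hzS₁ hzS₂ v hv
  set z' := z + t • ν with hz'
  have ha : 1 / 2 < fderiv ℝ ρ z' ν := ha
  have hb : ‖fderiv ℝ ρ z'‖ < M₁ := hb
  have hc : ‖fderiv ℝ (fderiv ℝ ρ) z'‖ < M₂ := hc
  have hIv : ‖Complex.I • v‖ = ‖v‖ := by simp [norm_smul]
  obtain ⟨c, hc1, hc2, hc3⟩ := exists_complexTangent ha.le v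
  set v' := v - c • ν with hv'
  set X := |ρ z|
  set Y := |fderiv ℝ ρ z v| + |fderiv ℝ ρ z (Complex.I • v)|
  have hX : 0 ≤ X := abs_nonneg _
  have hY : 0 ≤ Y := by positivity
  have hdist : dist z z' ≤ 2 * X * ‖ν‖ := by
    rw [hz', dist_self_add_right, norm_smul]; gcongr; exact ht
  have hAz (w : E) (hw : ‖w‖ ≤ K) :
      |fderiv ℝ ρ z' w| ≤ |fderiv ℝ ρ z w| + L₁ * (2 * X * ‖ν‖) * K := by
    have h5 : |fderiv ℝ ρ z' w - fderiv ℝ ρ z w| ≤ L₁ * (2 * X * ‖ν‖) * K := by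
      have h6 := hL₁.dist_le_mul _ hz₁ _ hzS₁
      rw [dist_eq_norm, dist_comm] at h6
      calc |fderiv ℝ ρ z' w - fderiv ℝ ρ z w| = ‖(fderiv ℝ ρ z' - fderiv ℝ ρ z) w‖ := rfl
        _ ≤ ‖fderiv ℝ ρ z' - fderiv ℝ ρ z‖ * ‖w‖ := ContinuousLinearMap.le_opNorm _ _
        _ ≤ (L₁ * (2 * X * ‖ν‖)) * K := by
          gcongr
          exact h6.trans (by gcongr)
    have := abs_sub_abs_le_abs_sub (fderiv ℝ ρ z' w) (fderiv ℝ ρ z w)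
    linarith
  have hcn : ‖c‖ ≤ c₁ * (X + Y) := by
    have i1 := hAz v hv
    have i2 := hAz (Complex.I • v) (hIv.trans_le hv)
    have i3 : 0 ≤ 8 * L₁ * K * ‖ν‖ * Y := by positivity
    have : ‖c‖ ≤ 2 * (Y + 2 * (L₁ * (2 * X * ‖ν‖) * K)) := by
      refine hc3.trans ?_
      simp only [Y]; linarith
    rw [hc₁]
    nlinarith
  have hcn' : ‖c‖ ≤ 4 * M₁ * K := by
    have i1 := (fderiv ℝ ρ z').le_opNorm v
    have i2 := (fderiv ℝ ρ z').le_opNorm (Complex.I • v)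
    rw [Real.norm_eq_abs] at i1 i2
    rw [hIv] at i2
    have : ‖fderiv ℝ ρ z'‖ * ‖v‖ ≤ M₁ * K := by gcongr
    linarith
  have hvv : ‖v - v'‖ = ‖c‖ * ‖ν‖ := by rw [hv', sub_sub_cancel, norm_smul]
  have hv'K : ‖v'‖ ≤ K' := by
    refine (norm_sub_le _ _).trans ?_
    rw [norm_smul]
    exact add_le_add hv (by gcongr)
  have hBB : ‖fderiv ℝ (fderiv ℝ ρ) z - fderiv ℝ (fderiv ℝ ρ) z'‖ ≤ L₂ * (2 * X * ‖ν‖) := by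
    have h6 := hL₂.dist_le_mul _ hzS₂ _ hz₂
    rw [dist_eq_norm] at h6
    exact h6.trans (by gcongr)
  have key (w w' : E) (hw : ‖w‖ ≤ K) (hw' : ‖w'‖ ≤ K') (hww : ‖w - w'‖ = ‖c‖ * ‖ν‖) :
      |fderiv ℝ (fderiv ℝ ρ) z w w - fderiv ℝ (fderiv ℝ ρ) z' w' w'| ≤
        (2 * L₂ * ‖ν‖ * K * K + M₂ * ‖ν‖ * c₁ * (K + K')) * (X + Y) := by
    refine (abs_apply_sub_apply_le _ _ w w').trans ?_
    calc _ ≤ L₂ * (2 * X * ‖ν‖) * K * K + M₂ * (c₁ * (X + Y) * ‖ν‖) * (K + K') := by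
          rw [hww]; gcongr
      _ ≤ L₂ * (2 * (X + Y) * ‖ν‖) * K * K + M₂ * (c₁ * (X + Y) * ‖ν‖) * (K + K') := by
          gcongr; linarith
      _ = _ := by ring
  have k1 := key v v' hv hv'K hvv
  have hIvv : ‖Complex.I • v - Complex.I • v'‖ = ‖c‖ * ‖ν‖ := by
    rw [← smul_sub, norm_smul, Complex.norm_I, one_mul, hvv]
  have hIv' : ‖Complex.I • v'‖ ≤ K' := by rw [norm_smul, Complex.norm_I, one_mul]; exact hv'K
  have k2 := key (Complex.I • v) (Complex.I • v') (hIv.trans_le hv) hIv' hIvv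
  have k3 := he hz0 v' ⟨hc1, hc2⟩
  rw [leviForm] at k3 ⊢
  have k1' := (abs_le.1 k1).1
  have k2' := (abs_le.1 k2).1
  linarith

/-- The Levi form is invariant under composition with holomorphic curves. -/
theorem leviForm_comp [CompleteSpace E] {ρ : E → ℝ} {φ : ℂ → E} {ζ : ℂ} (hφ : AnalyticAt ℂ φ ζ)
    (hρ : ContDiffAt ℝ 2 ρ (φ ζ)) (e : ℂ) :
    leviForm (fun ξ => ρ (φ ξ)) ζ e = leviForm ρ (φ ζ) (e • deriv φ ζ) := by
  have hd (ξ : ℂ) (hξ : AnalyticAt ℂ φ ξ) :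
      HasFDerivAt φ ((ContinuousLinearMap.toSpanSingleton ℂ (deriv φ ξ)).restrictScalars ℝ) ξ :=
    hξ.differentiableAt.hasDerivAt.hasFDerivAt.restrictScalars ℝ
  have hf : ∀ᶠ ξ in 𝓝 ζ, fderiv ℝ (fun ξ => ρ (φ ξ)) ξ = (fderiv ℝ ρ (φ ξ)).comp
      ((ContinuousLinearMap.toSpanSingleton ℂ (deriv φ ξ)).restrictScalars ℝ) := by
    filter_upwards [hφ.eventually_analyticAt,
      hφ.continuousAt.eventually (hρ.eventually (by simp))] with ξ h1 h2
    exact ((h2.differentiableAt (by simp)).hasFDerivAt.comp ξ (hd ξ h1)).fderiv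
  have hsmooth : ContDiffAt ℝ 2 (fun ξ => ρ (φ ξ)) ζ :=
    ContDiffAt.comp ζ (g := ρ) hρ (hφ.contDiffAt.restrict_scalars ℝ)
  have h2 (w : ℂ) : fderiv ℝ (fderiv ℝ fun ξ => ρ (φ ξ)) ζ w w =
      fderiv ℝ (fderiv ℝ ρ) (φ ζ) (w • deriv φ ζ) (w • deriv φ ζ) +
        fderiv ℝ ρ (φ ζ) (w • w • deriv (deriv φ) ζ) := by
    have hA : HasFDerivAt (fun ξ => fderiv ℝ (fun ξ => ρ (φ ξ)) ξ w)
        ((fderiv ℝ (fderiv ℝ fun ξ => ρ (φ ξ)) ζ).flip w) ζ := by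
      have := ((hsmooth.fderiv_right (m := 1) (by norm_num)).differentiableAt (by simp)).hasFDerivAt.clm_apply
        (hasFDerivAt_const w ζ)
      simpa using this
    have hB : HasFDerivAt (fun ξ => fderiv ℝ ρ (φ ξ) (w • deriv φ ξ)) _ ζ :=
      ((((hρ.fderiv_right (m := 1) (by norm_num)).differentiableAt (by simp)).hasFDerivAt.comp ζ
        (hd ζ hφ)).clm_apply
        ((hφ.deriv.differentiableAt.hasDerivAt.hasFDerivAt.restrictScalars ℝ).const_smul w))
    have hAB : (fun ξ => fderiv ℝ (fun ξ => ρ (φ ξ)) ξ w) =ᶠ[𝓝 ζ]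
        fun ξ => fderiv ℝ ρ (φ ξ) (w • deriv φ ξ) := by
      filter_upwards [hf] with ξ hξ
      rw [hξ]; rfl
    have := congrArg (fun L => L w) (hA.unique (hB.congr_of_eventuallyEq hAB))
    refine this.trans ?_
    simp [add_comm]
  -- The term with the second derivative of `φ` is quadratic in the direction, so it changes sign
  -- from `e` to `i e` and cancels in the sum.
  have hI (u : E) : (Complex.I • e) • (Complex.I • e) • u = -(e • e • u) := by
    simp only [smul_smul, smul_eq_mul]
    rw [← neg_smul]; congr 1
    linear_combination e * e * Complex.I_mul_I
  rw [leviForm, leviForm, h2, h2, hI, map_neg, smul_assoc Complex.I e]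
  ring
end

/-! ### Subharmonic leading parts and the absence of cancellation. -/

section

open Filter Topology Asymptotics

theorem nonneg_of_eventually_neg_mul_le {L C : ℝ} (h : ∀ᶠ s : ℝ in 𝓝[>] 0, -(C * s) ≤ L) :
    0 ≤ L := by
  have h2 : Tendsto (fun s : ℝ => -(C * s)) (𝓝[>] 0) (𝓝 0) := by
    have : Continuous fun s : ℝ => -(C * s) := by fun_prop
    simpa using (this.tendsto 0).mono_left nhdsWithin_le_nhds
  exact le_of_tendsto h2 h

theorem tendsto_smul_nhdsGT {D : Type*} [NormedAddCommGroup D] [NormedSpace ℝ D] (x : D) :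
    Tendsto (fun s : ℝ => s • x) (𝓝[>] 0) (𝓝 0) := by
  have : Continuous fun s : ℝ => s • x := by fun_prop
  simpa using (this.tendsto 0).mono_left nhdsWithin_le_nhds

/-- Evaluate at `s • x` and divide by `s ^ N`: the remainder contributes only `O(s)`. -/
theorem homogeneous_part_nonneg {D : Type} [NormedAddCommGroup D] [NormedSpace ℝ D]
    {g Q : D → ℝ} {N : ℕ} (hg : ContDiffAt ℝ ∞ g 0) (hg0 : ∀ᶠ x in 𝓝 0, 0 ≤ g x)
    (hQs : ContDiff ℝ ∞ Q) (hQh : ∀ (t : ℝ) x, Q (t • x) = t ^ N • Q x)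
    (hQo : ((N + 1 : ℕ) : ℕ∞) ≤ order (fun x => g x - Q x) 0) (x : D) : 0 ≤ Q x := by
  obtain ⟨C, hC⟩ := (isBigO_of_le_order (N + 1) (hg.sub hQs.contDiffAt) hQo).bound
  refine nonneg_of_eventually_neg_mul_le (C := C * ‖x‖ ^ (N + 1)) ?_
  filter_upwards [(tendsto_smul_nhdsGT x).eventually (hC.and hg0), self_mem_nhdsWithin]
    with s ⟨h1, h2⟩ hs
  have hs : 0 < s := hs
  rw [hQh, smul_eq_mul, norm_pow, norm_norm, norm_smul, Real.norm_of_nonneg hs.le,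
    Real.norm_eq_abs] at h1
  have h3 := (abs_le.1 h1).2
  refine le_of_mul_le_mul_left ?_ (pow_pos hs N)
  calc s ^ N * -(C * ‖x‖ ^ (N + 1) * s) = -(C * (s * ‖x‖) ^ (N + 1)) := by ring
    _ ≤ s ^ N * Q x := by linarith

/-- A nonpositive homogeneous function on the plane of positive degree that is subharmonic
vanishes. -/
theorem eq_zero_of_leviForm_nonneg {Q : ℂ → ℝ} {N : ℕ} (hN : N ≠ 0) (hQs : ContDiff ℝ ∞ Q)
    (hQh : ∀ (t : ℝ) x, Q (t • x) = t ^ N • Q x) (hQ : ∀ x, Q x ≤ 0)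
    (hL : ∀ e, 0 ≤ leviForm Q e e) (x : ℂ) : Q x = 0 := by
  -- In logarithmic coordinates homogeneity becomes `R (ζ + s) = exp (N s) R ζ`, so the second
  -- derivative of `R` in the real direction is `N ^ 2 * R`.
  set R : ℂ → ℝ := fun ζ => Q (Complex.exp ζ) with hR
  have hRs : ContDiff ℝ ∞ R := hQs.comp (Complex.contDiff_exp (𝕜 := ℝ))
  have hRd : Differentiable ℝ R := hRs.differentiable (by simp)
  have hRd' : Differentiable ℝ (fderiv ℝ R) :=
    (hRs.fderiv_right (m := ∞) (by simp)).differentiable (by simp)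
  have hRL (ζ : ℂ) : 0 ≤ leviForm R ζ 1 := by
    have := leviForm_comp (φ := Complex.exp) (ζ := ζ) (ρ := Q)
      (Complex.differentiable_exp.analyticAt ζ) (eventually_contDiffAt hQs.contDiffAt 2).self_of_nhds 1
    rw [this, Complex.deriv_exp, one_smul]
    exact hL _
  have hR1 (ζ : ℂ) : fderiv ℝ R ζ 1 = N * R ζ := by
    have h1 : HasDerivAt (fun s : ℝ => R (ζ + s • (1 : ℂ))) (fderiv ℝ R ζ 1) 0 := by
      have h := (hRd (ζ + (0 : ℝ) • (1 : ℂ))).hasFDerivAt.comp_hasDerivAt (0 : ℝ)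
        (((hasDerivAt_id (0 : ℝ)).smul_const (1 : ℂ)).const_add ζ)
      simpa [Function.comp_def] using h
    have h2 : HasDerivAt (fun s : ℝ => Real.exp s ^ N * R ζ) (N * R ζ) 0 := by
      simpa using ((Real.hasDerivAt_exp 0).pow N).mul_const (R ζ)
    refine h1.unique (h2.congr_of_eventuallyEq (Eventually.of_forall fun s => ?_))
    have e : Complex.exp (ζ + s • (1 : ℂ)) = Real.exp s • Complex.exp ζ := by
      rw [Complex.exp_add, Complex.real_smul, Complex.real_smul, mul_one, Complex.ofReal_exp,
        mul_comm]
    simp only [hR, e, hQh, smul_eq_mul]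
  have hR11 (ζ : ℂ) : fderiv ℝ (fderiv ℝ R) ζ 1 1 = N ^ 2 * R ζ := by
    have h1 : HasFDerivAt (fun ζ => fderiv ℝ R ζ 1) ((fderiv ℝ (fderiv ℝ R) ζ).flip 1) ζ := by
      simpa using (hRd' ζ).hasFDerivAt.clm_apply (hasFDerivAt_const (1 : ℂ) ζ)
    have h2 : HasFDerivAt (fun ζ => N * R ζ) ((N : ℝ) • fderiv ℝ R ζ) ζ :=
      (hRd ζ).hasFDerivAt.const_mul _
    simp only [hR1] at h1
    have := congrArg (fun L => L 1) (h1.unique h2)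
    simp only [ContinuousLinearMap.flip_apply, _root_.smul_apply, hR1, smul_eq_mul] at this
    rw [this]; ring
  have hRII (ζ : ℂ) : -(N ^ 2 * R ζ) ≤ fderiv ℝ (fderiv ℝ R) ζ Complex.I Complex.I := by
    have := hRL ζ
    rw [leviForm, hR11, smul_eq_mul, mul_one] at this
    linarith
  -- Subharmonicity and `R ≤ 0` make `R` convex in the angle. Its angular derivative `G` is monotone
  -- and periodic, hence constant, so `0 ≥ -(N ^ 2 * R)` and `R` vanishes.
  set G : ℝ → ℝ := fun θ => fderiv ℝ R (θ • Complex.I) Complex.I with hG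
  have hGd (θ : ℝ) : HasDerivAt G (fderiv ℝ (fderiv ℝ R) (θ • Complex.I) Complex.I Complex.I) θ := by
    have h := (hRd' (θ • Complex.I)).hasFDerivAt.comp_hasDerivAt θ
      ((hasDerivAt_id θ).smul_const Complex.I)
    simpa [Function.comp_def, hG] using h.clm_apply (hasDerivAt_const θ Complex.I)
  have hGm : Monotone G := by
    refine monotone_of_deriv_nonneg (fun θ => (hGd θ).differentiableAt) fun θ => ?_
    rw [(hGd θ).deriv]
    refine le_trans ?_ (hRII _)
    have : R (θ • Complex.I) ≤ 0 := hQ _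
    nlinarith [sq_nonneg (N : ℝ)]
  have hGp : Function.Periodic G (2 * Real.pi) := by
    intro θ
    have h1 : (fun ζ => R (ζ + 2 * Real.pi * Complex.I)) = R := by
      funext ζ; simp only [hR, Complex.exp_periodic ζ]
    have h2 := fderiv_comp_add_right (𝕜 := ℝ) (f := R) (x := θ • Complex.I)
      (2 * Real.pi * Complex.I)
    rw [h1] at h2
    simp only [hG]
    rw [h2]
    congr 2
    simp [add_mul]
  have hGc (a b : ℝ) (hab : a ≤ b) : G a = G b := by
    obtain ⟨n, hn⟩ := exists_nat_ge ((b - a) / (2 * Real.pi))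
    rw [div_le_iff₀ Real.two_pi_pos] at hn
    refine le_antisymm (hGm hab) ?_
    rw [← hGp.nat_mul n a]
    exact hGm (by linarith)
  have hR0 (θ : ℝ) : R (θ • Complex.I) = 0 := by
    have h1 : G = fun _ => G 0 := by
      funext a
      rcases le_total a 0 with h | h
      · exact hGc _ _ h
      · exact (hGc _ _ h).symm
    have h2 : fderiv ℝ (fderiv ℝ R) (θ • Complex.I) Complex.I Complex.I = 0 := by
      rw [← (hGd θ).deriv, h1, deriv_const]
    have h3 := hRII (θ • Complex.I)
    rw [h2] at h3
    have h4 : 0 < (N : ℝ) ^ 2 := by positivity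
    refine le_antisymm (hQ _) ?_
    by_contra! h5
    nlinarith
  have h6 := hR0 x.arg
  rw [← Complex.norm_mul_exp_arg_mul_I x, ← Complex.real_smul, hQh]
  simp only [hR, Complex.real_smul] at h6
  rw [h6, smul_zero]

variable {E : Type} [NormedAddCommGroup E] [NormedSpace ℝ E] [NormedSpace ℂ E]
  [IsScalarTower ℝ ℂ E]

theorem fderiv_comp_holomorphic {ρ : E → ℝ} {φ : ℂ → E} {ζ : ℂ} (hφ : DifferentiableAt ℂ φ ζ)
    (hρ : DifferentiableAt ℝ ρ (φ ζ)) (w : ℂ) :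
    fderiv ℝ (fun ξ => ρ (φ ξ)) ζ w = fderiv ℝ ρ (φ ζ) (w • deriv φ ζ) :=
  congrArg (fun L => L w)
    (hρ.hasFDerivAt.comp ζ (hφ.hasDerivAt.hasFDerivAt.restrictScalars ℝ)).fderiv

/-- Along a holomorphic curve, the leading part of a defining function of a pseudoconvex
hypersurface is subharmonic. -/
theorem leviForm_homogeneous_part_nonneg [CompleteSpace E] {ρ : E → ℝ} {φ : ℂ → E}
    (hφ : AnalyticAt ℂ φ 0) (hρ : ContDiffAt ℝ ∞ ρ (φ 0)) (h0 : ρ (φ 0) = 0)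
    (hd : fderiv ℝ ρ (φ 0) ≠ 0)
    (hL : ∀ᶠ z in 𝓝 (φ 0), ρ z = 0 → ∀ v, IsComplexTangent ρ z v → 0 ≤ leviForm ρ z v)
    {N : ℕ} (hN : ((N + 1 : ℕ) : ℕ∞) ≤ order (fun ζ => ρ (φ ζ)) 0) {Q : ℂ → ℝ}
    (hQs : ContDiff ℝ ∞ Q) (hQh : ∀ (t : ℝ) x, Q (t • x) = t ^ (N + 1) • Q x)
    (hQo : ((N + 1 + 1 : ℕ) : ℕ∞) ≤ order (fun ζ => ρ (φ ζ) - Q ζ) 0) (e : ℂ) :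
    0 ≤ leviForm Q e e := by
  set f : ℂ → ℝ := fun ζ => ρ (φ ζ) with hf
  have hfs : ContDiffAt ℝ ∞ f 0 :=
    ContDiffAt.comp (0 : ℂ) (g := ρ) hρ (hφ.contDiffAt.restrict_scalars ℝ)
  have hgs : ContDiffAt ℝ ∞ (fun ζ => f ζ - Q ζ) 0 := hfs.sub hQs.contDiffAt
  obtain ⟨C₁, hC₁p, hC₁⟩ := (isBigO_of_le_order (N + 1) hfs hN).exists_nonneg
  obtain ⟨C₂, hC₂p, hC₂⟩ := (isBigO_of_le_order N (contDiffAt_fderiv hfs)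
    (succ_le_order_iff.1 hN).2).exists_nonneg
  obtain ⟨C₃, hC₃p, hC₃⟩ := (isBigO_of_le_order N (contDiffAt_fderiv (contDiffAt_fderiv hgs))
    (succ_le_order_iff.1 (succ_le_order_iff.1 hQo).2).2).exists_nonneg
  obtain ⟨C, hC, hb⟩ := exists_leviForm_lower_bound hρ h0 hd hL
    (K := ‖e‖ * (‖deriv φ 0‖ + 1)) (by positivity)
  have hdd : ∀ᶠ ζ in 𝓝 (0 : ℂ), fderiv ℝ (fderiv ℝ fun ζ => f ζ - Q ζ) ζ =
      fderiv ℝ (fderiv ℝ f) ζ - fderiv ℝ (fderiv ℝ Q) ζ := by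
    have h1 : (fderiv ℝ fun ζ => f ζ - Q ζ) =ᶠ[𝓝 0] fun ζ => fderiv ℝ f ζ - fderiv ℝ Q ζ := by
      filter_upwards [eventually_contDiffAt hfs 1] with ζ hζ
      exact fderiv_fun_sub (hζ.differentiableAt (by simp)) (hQs.differentiable (by simp) ζ)
    filter_upwards [h1.eventuallyEq_nhds, eventually_contDiffAt (contDiffAt_fderiv hfs) 1]
      with ζ h2 h3
    rw [h2.fderiv_eq]
    exact fderiv_fun_sub (h3.differentiableAt (by simp))
      ((contDiffAt_fderiv hQs.contDiffAt).differentiableAt (by simp))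
  have hdφ : ∀ᶠ ζ in 𝓝 (0 : ℂ), ‖deriv φ ζ‖ < ‖deriv φ 0‖ + 1 :=
    hφ.deriv.continuousAt.norm.eventually_lt_const (by linarith)
  have hsm : ∀ᶠ ζ in 𝓝 (0 : ℂ), ContDiffAt ℝ 2 ρ (φ ζ) :=
    hφ.continuousAt.eventually (eventually_contDiffAt hρ 2)
  refine nonneg_of_eventually_neg_mul_le
    (C := C * (C₁ * ‖e‖ ^ (N + 1) + 2 * C₂ * ‖e‖ ^ N * ‖e‖) + C₃ * ‖e‖ ^ N * ‖e‖ * ‖e‖) ?_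
  filter_upwards [(tendsto_smul_nhdsGT e).eventually ((hC₁.bound.and (hC₂.bound.and hC₃.bound)).and
    ((hdd.and hdφ).and (hsm.and (hφ.eventually_analyticAt.and (hφ.continuousAt.eventually hb))))),
    Ioo_mem_nhdsGT one_pos]
    with s ⟨⟨h1, h2, h3⟩, ⟨h4, h5⟩, h6, h7, h8⟩ ⟨hs, hs1⟩
  set ζ := s • e with hζ
  have hζn : ‖ζ‖ = s * ‖e‖ := by rw [hζ, norm_smul, Real.norm_of_nonneg hs.le]
  rw [norm_pow, norm_norm, hζn] at h1 h2 h3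
  have hfd (w : ℂ) : fderiv ℝ f ζ w = fderiv ℝ ρ (φ ζ) (w • deriv φ ζ) :=
    fderiv_comp_holomorphic h7.differentiableAt (h6.differentiableAt (by simp)) w
  have h9 := h8 (e • deriv φ ζ) (by rw [norm_smul]; gcongr)
  rw [← leviForm_comp h7 h6, ← smul_assoc, ← hfd, ← hfd] at h9
  have hIe : ‖Complex.I • e‖ = ‖e‖ := by simp
  have h10 (w : ℂ) (hw : ‖w‖ = ‖e‖) : |fderiv ℝ f ζ w| ≤ C₂ * (s * ‖e‖) ^ N * ‖e‖ := by
    rw [← hw, ← Real.norm_eq_abs, hw]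
    exact ((fderiv ℝ f ζ).le_opNorm w).trans (by rw [hw]; gcongr)
  have h11 (w : ℂ) (hw : ‖w‖ = ‖e‖) : |fderiv ℝ (fderiv ℝ f) ζ w w - fderiv ℝ (fderiv ℝ Q) ζ w w| ≤
      C₃ * (s * ‖e‖) ^ N * ‖e‖ * ‖e‖ := by
    have := (fderiv ℝ (fderiv ℝ fun ζ => f ζ - Q ζ) ζ).le_opNorm₂ w w
    rw [hw] at this
    rw [h4] at this h3
    exact this.trans (by gcongr)
  -- The second derivative of `Q` scales with exponent `N - 1`; the factor `s ^ 2` avoids the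
  -- subtraction. The errors are `O(s ^ N)`, one power better.
  have hQ2 (w : ℂ) : s ^ 2 * fderiv ℝ (fderiv ℝ Q) ζ w w =
      s ^ (N + 1) * fderiv ℝ (fderiv ℝ Q) e w w := by
    have hQd : Differentiable ℝ (fderiv ℝ Q) :=
      (hQs.fderiv_right (m := ∞) (by simp)).differentiable (by simp)
    have := fderiv_homogeneous hQd (fderiv_homogeneous (hQs.differentiable (by simp)) (a := 1)
      (fun x => by rw [one_smul]; exact hQh s x)) e
    have := congrArg (fun L => L w w) this
    simp only [_root_.smul_apply, smul_eq_mul] at this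
    rw [← this]; ring
  have h12 := (abs_le.1 (h11 e rfl)).2
  have h13 := (abs_le.1 (h11 _ hIe)).2
  have h14 := h10 e rfl
  have h15 := h10 _ hIe
  have h16 : s ^ 2 * leviForm Q ζ e = s ^ (N + 1) * leviForm Q e e := by
    rw [leviForm, leviForm]
    linear_combination (hQ2 e + hQ2 (Complex.I • e)) / 4
  have h17 : leviForm f ζ e - C₃ * (s * ‖e‖) ^ N * ‖e‖ * ‖e‖ ≤ leviForm Q ζ e := by
    have : 0 ≤ C₃ * (s * ‖e‖) ^ N * ‖e‖ * ‖e‖ := (abs_nonneg _).trans (h11 e rfl)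
    rw [leviForm, leviForm]; linarith
  have h18 : |f ζ| ≤ C₁ * s ^ N * ‖e‖ ^ (N + 1) := by
    rw [Real.norm_eq_abs] at h1
    refine h1.trans ?_
    rw [mul_pow, ← mul_assoc]
    have := pow_le_pow_of_le_one hs.le hs1.le N.le_succ
    gcongr C₁ * ?_ * _
  set c := C * (C₁ * ‖e‖ ^ (N + 1) + 2 * C₂ * ‖e‖ ^ N * ‖e‖) + C₃ * ‖e‖ ^ N * ‖e‖ * ‖e‖ with hc
  have h19 : -(c * s ^ N) ≤ leviForm Q ζ e := by
    have h20 : C * (|f ζ| + (|fderiv ℝ f ζ e| + |fderiv ℝ f ζ (Complex.I • e)|)) ≤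
        C * (C₁ * s ^ N * ‖e‖ ^ (N + 1) + (C₂ * (s * ‖e‖) ^ N * ‖e‖ + C₂ * (s * ‖e‖) ^ N * ‖e‖)) := by
      gcongr
    calc -(c * s ^ N) = -(C * (C₁ * s ^ N * ‖e‖ ^ (N + 1) +
          (C₂ * (s * ‖e‖) ^ N * ‖e‖ + C₂ * (s * ‖e‖) ^ N * ‖e‖))) -
          C₃ * (s * ‖e‖) ^ N * ‖e‖ * ‖e‖ := by rw [hc]; ring
      _ ≤ leviForm Q ζ e := by linarith
  refine le_of_mul_le_mul_left ?_ (pow_pos hs (N + 1))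
  calc s ^ (N + 1) * -(c * s) = s ^ 2 * -(c * s ^ N) := by ring
    _ ≤ s ^ 2 * leviForm Q ζ e := by gcongr
    _ = _ := h16

/-- There is no cancellation between a pseudoconvex defining function along a holomorphic curve and
a nonnegative function. -/
theorem le_order_of_le_order_add [CompleteSpace E] {ρ : E → ℝ} {φ : ℂ → E} {g : ℂ → ℝ}
    (hφ : AnalyticAt ℂ φ 0) (hρ : ContDiffAt ℝ ∞ ρ (φ 0)) (h0 : ρ (φ 0) = 0)
    (hd : fderiv ℝ ρ (φ 0) ≠ 0)
    (hL : ∀ᶠ z in 𝓝 (φ 0), ρ z = 0 → ∀ v, IsComplexTangent ρ z v → 0 ≤ leviForm ρ z v)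
    (hg : ContDiffAt ℝ ∞ g 0) (hg0 : g 0 = 0) (hgn : ∀ᶠ ζ in 𝓝 0, 0 ≤ g ζ) (N : ℕ)
    (hN : (N : ℕ∞) ≤ order (fun ζ => ρ (φ ζ) + g ζ) 0) :
    (N : ℕ∞) ≤ order (fun ζ => ρ (φ ζ)) 0 ∧ (N : ℕ∞) ≤ order g 0 := by
  have hfs : ContDiffAt ℝ ∞ (fun ζ => ρ (φ ζ)) 0 :=
    ContDiffAt.comp (0 : ℂ) (g := ρ) hρ (hφ.contDiffAt.restrict_scalars ℝ)
  induction N with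
  | zero => simp
  | succ N ih =>
    obtain ⟨i1, i2⟩ := ih (le_trans (by exact_mod_cast N.le_succ) hN)
    cases N with
    -- Order one comes from the values at the origin, since the vanishing of `Q` requires positive
    -- degree.
    | zero => exact ⟨succ_le_order_iff.2 ⟨h0, by simp⟩, succ_le_order_iff.2 ⟨hg0, by simp⟩⟩
    | succ k =>
      obtain ⟨Q, hQs, hQh, hQo⟩ := exists_homogeneous_part _ hfs i1
      obtain ⟨P, hPs, hPh, hPo⟩ := exists_homogeneous_part _ hg i2
      have hO := ((isBigO_of_le_order _ (hfs.add hg) hN).sub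
        (isBigO_of_le_order _ (hfs.sub hQs.contDiffAt) hQo)).sub
        (isBigO_of_le_order _ (hg.sub hPs.contDiffAt) hPo)
      have hQP : ∀ ζ, Q ζ + P ζ = 0 := by
        refine eq_zero_of_homogeneous (a := 0) (b := k + 1) (c := k + 1 + 1) (by omega) ?_
          (hO.congr_left fun ζ => by ring)
        intro t x
        rw [hQh, hPh, pow_zero, one_smul, smul_add]
      have hPn := homogeneous_part_nonneg hg hgn hPs hPh hPo
      have hQ0 : ∀ ζ, Q ζ = 0 := eq_zero_of_leviForm_nonneg (Nat.succ_ne_zero k) hQs hQh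
        (fun ζ => by linarith [hPn ζ, hQP ζ])
        (leviForm_homogeneous_part_nonneg hφ hρ h0 hd hL i1 hQs hQh hQo)
      have hP0 : ∀ ζ, P ζ = 0 := fun ζ => by linarith [hQ0 ζ, hQP ζ]
      exact ⟨by simpa [hQ0] using hQo, by simpa [hP0] using hPo⟩

end

/-! ### The boundary as a zero set, and the type of a sum. -/

section

open Filter Topology Asymptotics

/-- A zero of `r` not adherent to the sublevel set would be a local minimum, contradicting the
nonzero gradient. -/
theorem mem_frontier_sublevel_iff {X : Type*} [NormedAddCommGroup X] [NormedSpace ℝ X]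
    {W : Set X} (hW : IsOpen W) {r : X → ℝ} (hr : ContinuousOn r W)
    (hd : ∀ x ∈ W, fderiv ℝ r x ≠ 0) {x : X} (hx : x ∈ W) :
    x ∈ frontier {y | y ∈ W ∧ r y < 0} ↔ r x = 0 := by
  have hopen : IsOpen {y | y ∈ W ∧ r y < 0} := hr.isOpen_inter_preimage hW isOpen_Iio
  have hopen' : IsOpen {y | y ∈ W ∧ 0 < r y} := hr.isOpen_inter_preimage hW isOpen_Ioi
  rw [hopen.frontier_eq]
  constructor
  · rintro ⟨h1, h2⟩
    refine le_antisymm ?_ (not_lt.1 fun h => h2 ⟨hx, h⟩)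
    by_contra! h3
    obtain ⟨y, hy, hy'⟩ := mem_closure_iff.1 h1 _ hopen' ⟨hx, h3⟩
    exact lt_asymm hy.2 hy'.2
  · intro h0
    refine ⟨mem_closure_iff.2 fun o ho hxo => ?_, fun h => h.2.ne h0⟩
    by_contra hcon
    have hmin : IsLocalMin r x := by
      filter_upwards [ho.mem_nhds hxo, hW.mem_nhds hx] with y hy hyW
      rw [h0]
      exact not_lt.1 fun h => hcon ⟨y, hy, hyW, h⟩
    exact hd x hx hmin.fderiv_eq_zero

section
variable {E F : Type} [NormedAddCommGroup E] [NormedSpace ℝ E]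
  [NormedAddCommGroup F] [NormedSpace ℝ F]

theorem natCast_le_order_prod_iff {ψ : ℂ → E} {χ : ℂ → F} (hψ : ContDiffAt ℝ ∞ ψ 0)
    (hχ : ContDiffAt ℝ ∞ χ 0) {N : ℕ} :
    (N : ℕ∞) ≤ order (fun ζ => (ψ ζ, χ ζ)) 0 ↔ (N : ℕ∞) ≤ order ψ 0 ∧ (N : ℕ∞) ≤ order χ 0 := by
  rw [le_order_iff_isBigO hψ, le_order_iff_isBigO hχ, le_order_iff_isBigO (hψ.prodMk hχ),
    isBigO_prod_left]

theorem order_prod {ψ : ℂ → E} {χ : ℂ → F} (hψ : ContDiffAt ℝ ∞ ψ 0)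
    (hχ : ContDiffAt ℝ ∞ χ 0) :
    order (fun ζ => (ψ ζ, χ ζ)) 0 = min (order ψ 0) (order χ 0) :=
  le_antisymm
    (ENat.forall_natCast_le_iff_le.1 fun _ h => le_min_iff.2 ((natCast_le_order_prod_iff hψ hχ).1 h))
    (ENat.forall_natCast_le_iff_le.1 fun _ h => (natCast_le_order_prod_iff hψ hχ).2 (le_min_iff.1 h))

theorem order_zero (x : ℂ) : order (fun _ : ℂ => (0 : E)) x = ⊤ := by
  refine ENat.eq_top_iff_forall_ge.2 fun N => le_order_iff.2 fun k _ => ?_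
  exact congrFun iteratedFDeriv_fun_zero x

end

theorem div_le_typeAt {E : Type*} [NormedAddCommGroup E] [NormedSpace ℝ E] [NormedSpace ℂ E]
    (k : E → ℝ) (p : E) {φ : ℂ → E} (hφ : IsDisc φ) :
    (order (fun ζ => k (p + φ ζ)) 0 : ℝ≥0∞) / (order φ 0 : ℝ≥0∞) ≤ typeAt k p :=
  le_iSup₂_of_le (f := fun (φ : ℂ → E) (_ : IsDisc φ) =>
    (order (fun ζ => k (p + φ ζ)) 0 : ℝ≥0∞) / (order φ 0 : ℝ≥0∞)) φ hφ le_rfl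

variable {E F : Type} [NormedAddCommGroup E] [NormedSpace ℝ E] [NormedSpace ℂ E]
  [IsScalarTower ℝ ℂ E] [CompleteSpace E] [NormedAddCommGroup F] [NormedSpace ℝ F]
  [NormedSpace ℂ F] [IsScalarTower ℝ ℂ F] [CompleteSpace F]

theorem isDisc_of_order_ne_top {ψ : ℂ → E} (hψ : DifferentiableOn ℂ ψ (Metric.ball 0 1))
    (h0 : ψ 0 = 0) (ho : order ψ 0 ≠ ⊤) : IsDisc ψ := by
  refine ⟨hψ, h0, ?_⟩
  by_contra! hz
  refine ho ?_
  rw [order_congr (g' := fun _ => (0 : E)), order_zero]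
  filter_upwards [Metric.ball_mem_nhds (0 : ℂ) one_pos] with ζ hζ using hz ζ hζ

/-- The type of a sum `ρ z + h w` of a pseudoconvex defining function and a nonnegative function
in separate variables. -/
theorem typeAt_add {ρ : E → ℝ} {z₀ : E} {h : F → ℝ} (hρ : ContDiffAt ℝ ∞ ρ z₀) (h0 : ρ z₀ = 0)
    (hd : fderiv ℝ ρ z₀ ≠ 0)
    (hL : ∀ᶠ z in 𝓝 z₀, ρ z = 0 → ∀ v, IsComplexTangent ρ z v → 0 ≤ leviForm ρ z v)
    (hh : ContDiffAt ℝ ∞ h 0) (hh0 : h 0 = 0) (hhn : ∀ᶠ w in 𝓝 0, 0 ≤ h w) :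
    typeAt (fun p : E × F => ρ p.1 + h p.2) (z₀, 0) = max (typeAt ρ z₀) (typeAt h 0) := by
  refine le_antisymm (iSup₂_le fun φ hφ => ?_) (max_le (iSup₂_le fun ψ hψ => ?_)
    (iSup₂_le fun χ hχ => ?_))
  · set ψ : ℂ → E := fun ζ => (φ ζ).1 with hψdef
    set χ : ℂ → F := fun ζ => (φ ζ).2 with hχdef
    have hψ : DifferentiableOn ℂ ψ (Metric.ball 0 1) := hφ.holomorphic.fst
    have hχ : DifferentiableOn ℂ χ (Metric.ball 0 1) := hφ.holomorphic.snd
    have hψ0 : ψ 0 = 0 := by simp [hψdef, hφ.map_zero]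
    have hχ0 : χ 0 = 0 := by simp [hχdef, hφ.map_zero]
    have hψa := hψ.analyticAt (Metric.ball_mem_nhds 0 one_pos)
    have hχa := hχ.analyticAt (Metric.ball_mem_nhds 0 one_pos)
    have hψs : ContDiffAt ℝ ∞ ψ 0 := hψa.contDiffAt.restrict_scalars ℝ
    have hχs : ContDiffAt ℝ ∞ χ 0 := hχa.contDiffAt.restrict_scalars ℝ
    have hord : order φ 0 = min (order ψ 0) (order χ 0) := order_prod hψs hχs
    have hg := contDiffAt_comp_disc hχs hχ0 hh
    have hle : order (fun ζ => ρ (z₀ + ψ ζ) + h (0 + χ ζ)) 0 ≤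
        min (order (fun ζ => ρ (z₀ + ψ ζ)) 0) (order (fun ζ => h (0 + χ ζ)) 0) := by
      refine ENat.forall_natCast_le_iff_le.1 fun N hN => le_min_iff.2 ?_
      have e : z₀ + ψ 0 = z₀ := by rw [hψ0, add_zero]
      exact le_order_of_le_order_add (φ := fun ζ => z₀ + ψ ζ) (analyticAt_const.add hψa)
        (by rwa [e]) (by rwa [e]) (by rwa [e]) (by rwa [e]) hg (by simp [hχ0, hh0])
        ((tendsto_disc hχs hχ0 0).eventually hhn) N hN
    change (order (fun ζ => ρ (z₀ + ψ ζ) + h (0 + χ ζ)) 0 : ℝ≥0∞) / _ ≤ _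
    -- Division by `⊤` is `0` in `ℝ≥0∞`, even for `⊤ / ⊤`, so the identity theorem is not needed
    -- here.
    by_cases htop : order φ 0 = ⊤
    · simp [htop]
    -- The component of smaller order has finite order, so it is a nonzero disc; the other one may
    -- be identically zero.
    rcases le_total (order ψ 0) (order χ 0) with hc | hc
    · rw [min_eq_left hc] at hord
      rw [hord] at htop ⊢
      refine le_max_of_le_left (le_trans ?_
        (div_le_typeAt ρ z₀ (isDisc_of_order_ne_top hψ hψ0 htop)))
      gcongr
      exact hle.trans (min_le_left _ _)
    · rw [min_eq_right hc] at hord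
      rw [hord] at htop ⊢
      refine le_max_of_le_right (le_trans ?_
        (div_le_typeAt h 0 (isDisc_of_order_ne_top hχ hχ0 htop)))
      gcongr
      exact hle.trans (min_le_right _ _)
  · have hdisc : IsDisc fun ζ => (ψ ζ, (0 : F)) := by
      obtain ⟨ζ, hζ, hne⟩ := hψ.nonzero
      exact ⟨hψ.holomorphic.prodMk (differentiableOn_const _), by simp [hψ.map_zero],
        ζ, hζ, fun h => hne (congrArg Prod.fst h)⟩
    have := div_le_typeAt (fun p : E × F => ρ p.1 + h p.2) (z₀, 0) hdisc
    rw [order_prod hψ.contDiffAt contDiffAt_const, order_zero, min_eq_left le_top] at this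
    simpa [hh0] using this
  · have hdisc : IsDisc fun ζ => ((0 : E), χ ζ) := by
      obtain ⟨ζ, hζ, hne⟩ := hχ.nonzero
      exact ⟨(differentiableOn_const _).prodMk hχ.holomorphic, by simp [hχ.map_zero],
        ζ, hζ, fun h => hne (congrArg Prod.snd h)⟩
    have := div_le_typeAt (fun p : E × F => ρ p.1 + h p.2) (z₀, 0) hdisc
    rw [order_prod contDiffAt_const hχ.contDiffAt, order_zero, min_eq_right le_top] at this
    simpa [h0] using this

theorem IsLocalDefiningFunction.typeAt_eq {M : Set E} {p : E} {r r' : E → ℝ}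
    (hr : IsLocalDefiningFunction M p r) (hr' : IsLocalDefiningFunction M p r') :
    typeAt r p = typeAt r' p := by
  obtain ⟨hp, W, hW, hpW, hs, hd, hz⟩ := hr
  obtain ⟨-, W', hW', hpW', hs', hd', hz'⟩ := hr'
  refine typeAt_eq_of_zero_iff (hs.contDiffAt (hW.mem_nhds hpW)) ((hz p hpW).1 hp) (hd p hpW)
    (hs'.contDiffAt (hW'.mem_nhds hpW')) (hd' p hpW') ?_
  filter_upwards [hW.mem_nhds hpW, hW'.mem_nhds hpW'] with x hx hx'
  rw [← hz x hx, hz' x hx']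

end

end FiniteType
end

/-! ### The proposition. -/

theorem mainTheorem6 (n m : ℕ)
    (z₀ : EuclideanSpace ℂ (Fin n))
    (U : Set (EuclideanSpace ℂ (Fin n))) (hU : IsOpen U) (hz₀U : z₀ ∈ U)
    (V : Set (EuclideanSpace ℂ (Fin m))) (hV : IsOpen V) (h0V : (0 : EuclideanSpace ℂ (Fin m)) ∈ V)
    (ρ : EuclideanSpace ℂ (Fin n) → ℝ) (hρ : ContDiffOn ℝ ∞ ρ U)
    (hρz₀ : ρ z₀ = 0) (hρgrad : ∀ z ∈ U, fderiv ℝ ρ z ≠ 0)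
    (h : EuclideanSpace ℂ (Fin m) → ℝ) (hh : ContDiffOn ℝ ∞ h V)
    (hhnonneg : ∀ w ∈ V, 0 ≤ h w)
    (hhgrad : ∀ w ∈ V, w ≠ 0 → fderiv ℝ h w ≠ 0)
    (hhzero : ∀ w ∈ V, (h w ≠ 0 ↔ w ≠ 0))
    (hLevi : ∀ z ∈ U, ρ z = 0 → ∀ v : EuclideanSpace ℂ (Fin n),
      FiniteType.IsComplexTangent ρ z v → 0 ≤ FiniteType.leviForm ρ z v)
    (τ : ℝ≥0∞) (hτ : FiniteType.IsOfFiniteType {z | z ∈ U ∧ ρ z = 0} z₀ τ)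
    (htyp : FiniteType.typeAt h 0 < ⊤) :
    FiniteType.IsOfFiniteType
      (frontier {p : EuclideanSpace ℂ (Fin n) × EuclideanSpace ℂ (Fin m) |
        (p.1 ∈ U ∧ p.2 ∈ V) ∧ ρ p.1 + h p.2 < 0})
      (z₀, 0) (max τ (FiniteType.typeAt h 0)) := by
  have hh0 : h 0 = 0 := not_not.1 fun hne => (hhzero 0 h0V).1 hne rfl
  have hτ' : FiniteType.typeAt ρ z₀ = τ :=
    hτ.2.2 ρ ⟨⟨hz₀U, hρz₀⟩, U, hU, hz₀U, hρ, hρgrad, fun x hx => ⟨fun hm => hm.2, fun h0 => ⟨hx, h0⟩⟩⟩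
  set r : EuclideanSpace ℂ (Fin n) × EuclideanSpace ℂ (Fin m) → ℝ := fun p => ρ p.1 + h p.2 with hr
  have hW : IsOpen (U ×ˢ V) := hU.prod hV
  have hrs : ContDiffOn ℝ ∞ r (U ×ˢ V) :=
    (hρ.comp contDiffOn_fst fun p hp => hp.1).add (hh.comp contDiffOn_snd fun p hp => hp.2)
  have hrd : ∀ p ∈ U ×ˢ V, fderiv ℝ r p ≠ 0 := by
    intro p hp hzero
    refine hρgrad p.1 hp.1 (ContinuousLinearMap.ext fun v => ?_)
    have h1 : HasFDerivAt ρ (fderiv ℝ ρ p.1) p.1 :=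
      ((hρ.contDiffAt (hU.mem_nhds hp.1)).differentiableAt (by simp)).hasFDerivAt
    have h2 : HasFDerivAt h (fderiv ℝ h p.2) p.2 :=
      ((hh.contDiffAt (hV.mem_nhds hp.2)).differentiableAt (by simp)).hasFDerivAt
    have h3 := ((h1.comp p hasFDerivAt_fst).add (h2.comp p hasFDerivAt_snd)).fderiv
    have h4 := congrArg (fun L => L (v, 0)) (h3.symm.trans hzero)
    simpa using h4
  have hdef : FiniteType.IsLocalDefiningFunction (frontier {p : EuclideanSpace ℂ (Fin n) ×
      EuclideanSpace ℂ (Fin m) | (p.1 ∈ U ∧ p.2 ∈ V) ∧ ρ p.1 + h p.2 < 0}) (z₀, 0) r := by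
    have hz : ∀ x ∈ U ×ˢ V, x ∈ frontier {p : EuclideanSpace ℂ (Fin n) ×
        EuclideanSpace ℂ (Fin m) | (p.1 ∈ U ∧ p.2 ∈ V) ∧ ρ p.1 + h p.2 < 0} ↔ r x = 0 :=
      fun x hx => FiniteType.mem_frontier_sublevel_iff hW hrs.continuousOn hrd hx
    exact ⟨(hz _ ⟨hz₀U, h0V⟩).2 (by simp [hr, hρz₀, hh0]), _, hW, ⟨hz₀U, h0V⟩, hrs, hrd, hz⟩
  refine ⟨max_lt hτ.1 htyp, ⟨r, hdef⟩, fun r' hr' => ?_⟩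
  rw [hr'.typeAt_eq hdef, ← hτ']
  exact FiniteType.typeAt_add (hρ.contDiffAt (hU.mem_nhds hz₀U)) hρz₀ (hρgrad z₀ hz₀U)
    (Filter.mem_of_superset (hU.mem_nhds hz₀U) hLevi) (hh.contDiffAt (hV.mem_nhds h0V)) hh0
    (Filter.mem_of_superset (hV.mem_nhds h0V) hhnonneg)
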